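/- Let $k$ be an algebraically closed field of characteristic zero. Let $L$ be a reductive affine algebraic group over $k$ (not necessarily connected; reductive means that the only connected normal closed unipotent subgroup of $L$ is the trivial one), let $V$ be a finite-dimensional $k$-vector space, and let $\rho : L \to \mathrm{GL}(V)$ be a rational representation. Let $G = L \ltimes V$ be the corresponding semidirect product, an affine algebraic group. Let $h \in G$ be a unipotent element and let $H \subseteq G$ be the smallest algebraic (that is, Zariski closed) subgroup containing $h$. Then at least one of the following holds: 1. there is an element $h' \in L$ that is conjugate to $h$ in $G$; 2. the action of $H$ on $G$ by right translations, whose orbits are the cosets $gH$, has a section, that is, a Zariski closed subset $S \subseteq G$ that meets every orbit $gH$ in exactly one point and meets every irreducible component of $G$ in an irreducible (in particular non-empty) closed subset. -/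

import Mathlib

namespace AlgGrp

/-- An affine variety over `k` (classically: reduced, possibly reducible), presented by its set of
points `X` and its finitely generated algebra of regular functions `X → k`; every `k`-point of that
algebra is evaluation at exactly one point of `X`. -/
class AffineVariety (k : Type*) [Field k] (X : Type*) where
  /-- the coordinate algebra `k[X]` -/
  regular : Subalgebra k (X → k)
  fg : regular.FG
  existsUnique_eval : ∀ φ : regular →ₐ[k] k, ∃! x : X, ∀ f : regular, φ f = f.1 x

/-- The algebra `k[X]` of regular functions. -/
abbrev Reg (k : Type*) [Field k] (X : Type*) [AffineVariety k X] : Subalgebra k (X → k) :=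
  AffineVariety.regular

/-- Morphisms of affine varieties: maps that pull regular functions back to regular functions. -/
def IsMorphism (k : Type*) [Field k] {X Y : Type*} [AffineVariety k X] [AffineVariety k Y]
    (φ : X → Y) : Prop :=
  ∀ f ∈ Reg k Y, f ∘ φ ∈ Reg k X

/-- The Zariski topology: closed sets are the common zero sets of sets of regular functions. -/
@[reducible] def zariski (k : Type*) [Field k] (X : Type*) [AffineVariety k X] : TopologicalSpace X :=
  TopologicalSpace.ofClosed
    {Z : Set X | ∃ I : Set (X → k), I ⊆ Reg k X ∧ Z = {x | ∀ f ∈ I, f x = 0}}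
    ⟨{1}, by simp, by ext x; simp⟩
    (by
      intro A hA
      refine ⟨{f | f ∈ Reg k X ∧ ∃ Z ∈ A, ∀ x ∈ Z, f x = 0}, fun f hf => hf.1, ?_⟩
      ext x
      simp only [Set.mem_sInter, Set.mem_ofPred_eq]
      constructor
      · rintro hx f ⟨-, Z, hZ, hfZ⟩
        exact hfZ x (hx Z hZ)
      · intro hx Z hZ
        obtain ⟨I, hI, rfl⟩ := hA hZ
        exact fun f hf => hx f ⟨hI hf, _, hZ, fun y hy => hy f hf⟩)
    (by
      rintro _ ⟨I, hI, rfl⟩ _ ⟨J, hJ, rfl⟩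
      refine ⟨{p | ∃ f ∈ I, ∃ g ∈ J, p = f * g}, ?_, ?_⟩
      · rintro _ ⟨f, hf, g, hg, rfl⟩
        exact mul_mem (hI hf) (hJ hg)
      · ext x
        simp only [Set.mem_union, Set.mem_ofPred_eq]
        constructor
        · rintro (h | h) _ ⟨f, hf, g, hg, rfl⟩
          · simp [h f hf]
          · simp [h g hg]
        · intro h
          by_contra! hc
          obtain ⟨⟨f, hf, hfx⟩, ⟨g, hg, hgx⟩⟩ := hc
          exact mul_ne_zero hfx hgx (h _ ⟨f, hf, g, hg, rfl⟩))

/-- Zariski closed subsets. -/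
def IsZariskiClosed (k : Type*) [Field k] {X : Type*} [AffineVariety k X] (Z : Set X) : Prop :=
  @IsClosed X (zariski k X) Z

theorem isZariskiClosed_iff {k : Type*} [Field k] {X : Type*} [AffineVariety k X] {Z : Set X} :
    IsZariskiClosed k Z ↔
      ∃ I : Set (X → k), I ⊆ Reg k X ∧ Z = {x | ∀ f ∈ I, f x = 0} := by
  unfold IsZariskiClosed
  rw [← @isOpen_compl_iff X Z (zariski k X)]
  change Zᶜᶜ ∈ _ ↔ _
  rw [compl_compl]
  rfl

/-- Irreducible subsets (in particular nonempty) for the Zariski topology. -/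
def IsZariskiIrreducible (k : Type*) [Field k] {X : Type*} [AffineVariety k X] (Z : Set X) : Prop :=
  @IsIrreducible X (zariski k X) Z

/-- The set of irreducible components for the Zariski topology. -/
def components (k : Type*) [Field k] (X : Type*) [AffineVariety k X] : Set (Set X) :=
  @irreducibleComponents X (zariski k X)

/-! ### Products, vector spaces, transport along a bijection -/

/-- A `k`-algebra homomorphism `k[s] → k` that is evaluation at `x` on `s` is evaluation at `x`. -/
theorem eval_eq_of_adjoin {k : Type*} [Field k] {X : Type*} {s : Set (X → k)}
    (φ : Algebra.adjoin k s →ₐ[k] k) (x : X)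
    (h : ∀ (f : X → k) (hf : f ∈ s), φ ⟨f, Algebra.subset_adjoin hf⟩ = f x)
    (f : Algebra.adjoin k s) : φ f = f.1 x := by
  obtain ⟨f, hf⟩ := f
  induction hf using Algebra.adjoin_induction with
  | mem f hf => exact h f hf
  | algebraMap r => exact φ.commutes r
  | add f g hf hg ihf ihg =>
    exact (map_add φ ⟨f, hf⟩ ⟨g, hg⟩).trans (congrArg₂ (· + ·) ihf ihg)
  | mul f g hf hg ihf ihg =>
    exact (map_mul φ ⟨f, hf⟩ ⟨g, hg⟩).trans (congrArg₂ (· * ·) ihf ihg)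

/-- Pullback of functions along a map, as an algebra homomorphism. -/
def pullback (k : Type*) [Field k] {X Y : Type*} (φ : X → Y) : (Y → k) →ₐ[k] (X → k) where
  toFun f := f ∘ φ
  map_one' := rfl
  map_mul' _ _ := rfl
  map_zero' := rfl
  map_add' _ _ := rfl
  commutes' _ := rfl

/-- The product variety: `k[X × Y]` is generated by `k[X]` and `k[Y]`. -/
instance prodVariety (k : Type*) [Field k] (X Y : Type*) [AffineVariety k X] [AffineVariety k Y] :
    AffineVariety k (X × Y) where
  regular := Algebra.adjoin k
    (pullback k Prod.fst '' (Reg k X : Set (X → k)) ∪ pullback k Prod.snd '' (Reg k Y : Set (Y → k)))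
  fg := by
    rw [Algebra.adjoin_union, ← AlgHom.map_adjoin, ← AlgHom.map_adjoin, Algebra.adjoin_eq,
      Algebra.adjoin_eq]
    exact (AffineVariety.fg.map _).sup (AffineVariety.fg.map _)
  existsUnique_eval φ := by
    have h1 : ∀ f ∈ Reg k X, pullback k (Prod.fst : X × Y → X) f ∈ Algebra.adjoin k
        (pullback k (Prod.fst : X × Y → X) '' (Reg k X : Set (X → k)) ∪
          pullback k (Prod.snd : X × Y → Y) '' (Reg k Y : Set (Y → k))) :=
      fun f hf => Algebra.subset_adjoin (Or.inl ⟨f, hf, rfl⟩)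
    have h2 : ∀ f ∈ Reg k Y, pullback k (Prod.snd : X × Y → Y) f ∈ Algebra.adjoin k
        (pullback k (Prod.fst : X × Y → X) '' (Reg k X : Set (X → k)) ∪
          pullback k (Prod.snd : X × Y → Y) '' (Reg k Y : Set (Y → k))) :=
      fun f hf => Algebra.subset_adjoin (Or.inr ⟨f, hf, rfl⟩)
    obtain ⟨x, hx, hxu⟩ := AffineVariety.existsUnique_eval (k := k) (X := X)
      (φ.comp (((pullback k Prod.fst).comp (Reg k X).val).codRestrict _ fun f => h1 f.1 f.2))
    obtain ⟨y, hy, hyu⟩ := AffineVariety.existsUnique_eval (k := k) (X := Y)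
      (φ.comp (((pullback k Prod.snd).comp (Reg k Y).val).codRestrict _ fun f => h2 f.1 f.2))
    refine ⟨(x, y), eval_eq_of_adjoin φ (x, y) ?_, ?_⟩
    · rintro _ (⟨f, hf, rfl⟩ | ⟨f, hf, rfl⟩)
      · exact hx ⟨f, hf⟩
      · exact hy ⟨f, hf⟩
    · rintro ⟨x', y'⟩ h
      rw [hxu x' fun f => h ⟨_, h1 f.1 f.2⟩, hyu y' fun f => h ⟨_, h2 f.1 f.2⟩]

/-- A finite-dimensional vector space as an affine variety: `k[V]` is generated by the linear
forms. -/
@[reducible] def vectorSpaceVariety (k : Type*) [Field k] (V : Type*) [AddCommGroup V] [Module k V]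
    [FiniteDimensional k V] : AffineVariety k V where
  regular := Algebra.adjoin k (Set.range fun ξ : Module.Dual k V => (ξ : V → k))
  fg := by
    let b := Module.finBasis k V
    refine Subalgebra.fg_def.2 ⟨Set.range fun i => (b.coord i : V → k), Set.finite_range _, ?_⟩
    apply le_antisymm
    · apply Algebra.adjoin_mono
      rintro _ ⟨i, rfl⟩
      exact ⟨b.coord i, rfl⟩
    · apply Algebra.adjoin_le
      rintro _ ⟨ξ, rfl⟩
      have : (ξ : V → k) = ∑ i, ξ (b i) • (b.coord i : V → k) := by
        ext v
        have hv := congrArg ξ (b.sum_repr v)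
        rw [map_sum] at hv
        rw [← hv]
        simp [mul_comm]
      change (ξ : V → k) ∈ Algebra.adjoin k _
      rw [this]
      exact sum_mem fun i _ => Subalgebra.smul_mem _ (Algebra.subset_adjoin (Set.mem_range_self i)) _
  existsUnique_eval φ := by
    let T : Module.Dual k (Module.Dual k V) :=
      { toFun := fun ξ => φ ⟨ξ, Algebra.subset_adjoin ⟨ξ, rfl⟩⟩
        map_add' := fun ξ η => φ.map_add ⟨ξ, Algebra.subset_adjoin ⟨ξ, rfl⟩⟩
          ⟨η, Algebra.subset_adjoin ⟨η, rfl⟩⟩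
        map_smul' := fun c ξ => map_smul φ c ⟨ξ, Algebra.subset_adjoin ⟨ξ, rfl⟩⟩ }
    have hT : ∀ (v : V), (∀ ξ, T ξ = ξ v) ↔ Module.evalEquiv k V v = T := fun v =>
      ⟨fun h => LinearMap.ext fun ξ => (h ξ).symm, fun h ξ => by rw [← h]; rfl⟩
    refine ⟨(Module.evalEquiv k V).symm T, eval_eq_of_adjoin φ _ ?_, ?_⟩
    · rintro _ ⟨ξ, rfl⟩
      exact (hT _).2 (by simp) ξ
    · intro v hv
      rw [LinearEquiv.eq_symm_apply]
      exact (hT v).1 fun ξ => hv ⟨ξ, _⟩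

/-- Transport of the structure of an affine variety along a bijection. -/
@[reducible] def varietyOfEquiv (k : Type*) [Field k] {X Y : Type*} (e : X ≃ Y)
    [AffineVariety k Y] : AffineVariety k X where
  regular := (Reg k Y).map (pullback k e)
  fg := AffineVariety.fg.map _
  existsUnique_eval φ := by
    obtain ⟨y, hy, hyu⟩ := AffineVariety.existsUnique_eval (k := k) (X := Y)
      (φ.comp (((pullback k e).comp (Reg k Y).val).codRestrict ((Reg k Y).map (pullback k e))
        fun f => ⟨f.1, f.2, rfl⟩))
    refine ⟨e.symm y, ?_, ?_⟩
    · rintro ⟨_, f, hf, rfl⟩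
      refine (hy ⟨f, hf⟩).trans ?_
      exact congrArg f (e.apply_symm_apply y).symm
    · intro x hx
      rw [Equiv.eq_symm_apply]
      exact hyu _ fun f => hx ⟨_, f.1, f.2, rfl⟩

/-! ### Affine algebraic groups -/

/-- An affine algebraic group: a group on an affine variety whose multiplication and inversion are
morphisms. -/
class AffineAlgebraicGroup (k : Type*) [Field k] (G : Type*) [Group G] [AffineVariety k G] :
    Prop where
  mul_morphism : IsMorphism k fun p : G × G => p.1 * p.2
  inv_morphism : IsMorphism k fun g : G => g⁻¹

/-- `g` is unipotent: right translation by `g` acts locally unipotently on `k[G]`. -/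
def IsUnipotent (k : Type*) [Field k] {G : Type*} [Group G] [AffineVariety k G] (g : G) : Prop :=
  ∀ f ∈ Reg k G, ∃ n : ℕ,
    ((LinearMap.funLeft k k (fun x : G => x * g) - 1 : Module.End k (G → k)) ^ n) f = 0

/-- Algebraic subgroups: the Zariski closed ones. -/
def IsAlgebraicSubgroup (k : Type*) [Field k] {G : Type*} [Group G] [AffineVariety k G]
    (H : Subgroup G) : Prop :=
  IsZariskiClosed k (H : Set G)

/-- The group is reductive: its unipotent radical is trivial, that is, the only connected normal
algebraic subgroup that consists of unipotent elements is the trivial one. (The group itself need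
not be connected.) -/
def IsReductive (k : Type*) [Field k] (G : Type*) [Group G] [AffineVariety k G] : Prop :=
  ∀ U : Subgroup G, IsAlgebraicSubgroup k U → U.Normal →
    @IsConnected G (zariski k G) (U : Set G) → (∀ u ∈ U, IsUnipotent k u) → U = ⊥

/-- The smallest algebraic subgroup containing `g`. -/
def algebraicHull (k : Type*) [Field k] {G : Type*} [Group G] [AffineVariety k G] (g : G) :
    Subgroup G :=
  sInf {H : Subgroup G | IsAlgebraicSubgroup k H ∧ g ∈ H}

theorem isLeast_algebraicHull (k : Type*) [Field k] {G : Type*} [Group G] [AffineVariety k G]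
    (g : G) : IsLeast {H : Subgroup G | IsAlgebraicSubgroup k H ∧ g ∈ H} (algebraicHull k g) := by
  refine ⟨⟨?_, Subgroup.mem_sInf.2 fun H hH => hH.2⟩, fun H hH => sInf_le hH⟩
  unfold IsAlgebraicSubgroup IsZariskiClosed algebraicHull
  rw [Subgroup.coe_sInf]
  exact @isClosed_biInter G _ (zariski k G) _ _ fun H hH => hH.1

/-- `S` is a section of the action of `H` on `G` by right translations (whose orbits are the cosets
`gH`): it is closed, it meets every orbit in exactly one point, and it meets every irreducible
component of `G` in an irreducible set. -/
structure IsSection (k : Type*) [Field k] {G : Type*} [Group G] [AffineVariety k G]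
    (H : Subgroup G) (S : Set G) : Prop where
  closed : IsZariskiClosed k S
  meets_orbit_once : ∀ g : G, ∃! s : G, s ∈ S ∩ MulAction.orbit H.op g
  irreducible_inter : ∀ C ∈ components k G, IsZariskiIrreducible k (S ∩ C)

/-- The orbits in question are the cosets `gH`. -/
theorem orbit_op_eq {G : Type*} [Group G] (H : Subgroup G) (g : G) :
    MulAction.orbit H.op g = {x | ∃ h ∈ H, x = g * h} := by
  ext x
  constructor
  · rintro ⟨⟨h, hh⟩, rfl⟩
    exact ⟨h.unop, hh, rfl⟩
  · rintro ⟨h, hh, rfl⟩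
    exact ⟨⟨MulOpposite.op h, hh⟩, rfl⟩

/-! ### The semidirect product `L ⋉ V` -/

open LinearMap (GeneralLinearGroup)

/-- A homomorphism `ρ : L → GL(V)` is a (rational) representation of the algebraic group `L` when
its matrix coefficients are regular functions on `L`. -/
def IsRational (k : Type*) [Field k] {L : Type*} [Group L] [AffineVariety k L]
    {V : Type*} [AddCommGroup V] [Module k V] (ρ : L →* GeneralLinearGroup k V) : Prop :=
  ∀ (v : V) (ξ : Module.Dual k V), (fun l : L => ξ ((ρ l : V →ₗ[k] V) v)) ∈ Reg k L

/-- The action of `L` on the (multiplicatively written) additive group of `V` through `ρ`. -/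
def actionHom {k : Type*} [Field k] {L : Type*} [Group L]
    {V : Type*} [AddCommGroup V] [Module k V] (ρ : L →* GeneralLinearGroup k V) :
    L →* MulAut (Multiplicative V) where
  toFun l := AddEquiv.toMultiplicative (ρ l).toLinearEquiv.toAddEquiv
  map_one' := by rw [map_one]; rfl
  map_mul' a b := by rw [map_mul]; rfl

/-- The group `L ⋉ V` defined by `ρ`. Its elements are pairs `(v, l)`, and
`(v, l) (v', l') = (v + ρ(l) v', l l')`. -/
abbrev LV {k : Type*} [Field k] {L : Type*} [Group L]
    {V : Type*} [AddCommGroup V] [Module k V] (ρ : L →* GeneralLinearGroup k V) : Type _ :=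
  SemidirectProduct (Multiplicative V) L (actionHom ρ)

/-- The underlying variety of `L ⋉ V` is `V × L`. -/
instance varietyLV (k : Type*) [Field k] {L : Type*} [Group L] [AffineVariety k L]
    {V : Type*} [AddCommGroup V] [Module k V] [FiniteDimensional k V]
    (ρ : L →* GeneralLinearGroup k V) : AffineVariety k (LV ρ) :=
  letI : AffineVariety k V := vectorSpaceVariety k V
  varietyOfEquiv k (SemidirectProduct.equivProd.trans
    (Equiv.prodCongr Multiplicative.toAdd (Equiv.refl L)) : LV ρ ≃ V × L)

theorem mul_formula {k : Type*} [Field k] {L : Type*} [Group L]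
    {V : Type*} [AddCommGroup V] [Module k V] (ρ : L →* GeneralLinearGroup k V) (a b : LV ρ) :
    (a * b).left.toAdd = a.left.toAdd + (ρ a.right : V →ₗ[k] V) b.left.toAdd ∧
      (a * b).right = a.right * b.right :=
  ⟨rfl, rfl⟩

/-- `k[L ⋉ V]` is generated by the linear forms on `V` and the regular functions on `L`. -/
theorem reg_LV (k : Type*) [Field k] {L : Type*} [Group L] [AffineVariety k L]
    {V : Type*} [AddCommGroup V] [Module k V] [FiniteDimensional k V]
    (ρ : L →* GeneralLinearGroup k V) :
    Reg k (LV ρ) = Algebra.adjoin k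
      ({f | ∃ ξ : Module.Dual k V, f = fun g => ξ g.left.toAdd} ∪
        {f | ∃ p ∈ Reg k L, f = fun g => p g.right}) := by
  let : AffineVariety k V := vectorSpaceVariety k V
  let e : LV ρ ≃ V × L := SemidirectProduct.equivProd.trans
    (Equiv.prodCongr Multiplicative.toAdd (Equiv.refl L))
  change (Algebra.adjoin k (pullback k (Prod.fst : V × L → V) '' (Reg k V : Set (V → k)) ∪
    pullback k (Prod.snd : V × L → L) '' (Reg k L : Set (L → k)))).map (pullback k e) = _
  rw [AlgHom.map_adjoin, Set.image_union, Algebra.adjoin_union, Algebra.adjoin_union]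
  congr 1
  · rw [← AlgHom.map_adjoin, ← AlgHom.map_adjoin, Algebra.adjoin_eq]
    change ((Algebra.adjoin k (Set.range fun ξ : Module.Dual k V => (ξ : V → k))).map _).map _ = _
    rw [AlgHom.map_adjoin, AlgHom.map_adjoin]
    congr 1
    ext f
    constructor
    · rintro ⟨_, ⟨_, ⟨ξ, rfl⟩, rfl⟩, rfl⟩
      exact ⟨ξ, rfl⟩
    · rintro ⟨ξ, rfl⟩
      exact ⟨_, ⟨_, ⟨ξ, rfl⟩, rfl⟩, rfl⟩
  · congr 1
    ext f
    constructor
    · rintro ⟨_, ⟨p, hp, rfl⟩, rfl⟩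
      exact ⟨p, hp, rfl⟩
    · rintro ⟨p, hp, rfl⟩
      exact ⟨_, ⟨p, hp, rfl⟩, rfl⟩

theorem isMorphism_of_adjoin {k : Type*} [Field k] {X Y : Type*} [AffineVariety k X]
    [AffineVariety k Y] {s : Set (Y → k)} (hs : Reg k Y = Algebra.adjoin k s) (φ : X → Y)
    (h : ∀ f ∈ s, f ∘ φ ∈ Reg k X) : IsMorphism k φ := by
  have : Reg k Y ≤ (Reg k X).comap (pullback k φ) := by
    rw [hs]
    exact Algebra.adjoin_le h
  exact fun f hf => this hf

/-- For a rational representation, `L ⋉ V` is an affine algebraic group. -/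
theorem affineAlgebraicGroup_LV (k : Type*) [Field k] {L : Type*} [Group L] [AffineVariety k L]
    [AffineAlgebraicGroup k L]
    {V : Type*} [AddCommGroup V] [Module k V] [FiniteDimensional k V]
    (ρ : L →* GeneralLinearGroup k V) (hρ : IsRational k ρ) : AffineAlgebraicGroup k (LV ρ) := by
  have hV : ∀ ξ : Module.Dual k V, (fun g : LV ρ => ξ g.left.toAdd) ∈ Reg k (LV ρ) := by
    intro ξ
    rw [reg_LV]
    exact Algebra.subset_adjoin (Or.inl ⟨ξ, rfl⟩)
  have hL : ∀ p ∈ Reg k L, (fun g : LV ρ => p g.right) ∈ Reg k (LV ρ) := by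
    intro p hp
    rw [reg_LV]
    exact Algebra.subset_adjoin (Or.inr ⟨p, hp, rfl⟩)
  have h1 : ∀ f ∈ Reg k (LV ρ), (fun p : LV ρ × LV ρ => f p.1) ∈ Reg k (LV ρ × LV ρ) :=
    fun f hf => Algebra.subset_adjoin (Or.inl ⟨f, hf, rfl⟩)
  have h2 : ∀ f ∈ Reg k (LV ρ), (fun p : LV ρ × LV ρ => f p.2) ∈ Reg k (LV ρ × LV ρ) :=
    fun f hf => Algebra.subset_adjoin (Or.inr ⟨f, hf, rfl⟩)
  let b := Module.finBasis k V
  have expand : ∀ (ξ : Module.Dual k V) (T : V →ₗ[k] V) (v : V),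
      ξ (T v) = ∑ i, b.coord i v * ξ (T (b i)) := by
    intro ξ T v
    have hv := congrArg (fun w => ξ (T w)) (b.sum_repr v)
    simp only [map_sum] at hv
    rw [← hv]
    simp
  constructor
  · refine isMorphism_of_adjoin (reg_LV k ρ) _ ?_
    rintro _ (⟨ξ, rfl⟩ | ⟨p, hp, rfl⟩)
    · have : ((fun g : LV ρ => ξ g.left.toAdd) ∘ fun p : LV ρ × LV ρ => p.1 * p.2) =
          (fun p : LV ρ × LV ρ => ξ p.1.left.toAdd) + ∑ i,
            (fun p : LV ρ × LV ρ => b.coord i p.2.left.toAdd) *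
              (fun p : LV ρ × LV ρ => ξ ((ρ p.1.right : V →ₗ[k] V) (b i))) := by
        ext p
        simp only [Function.comp_apply, (mul_formula ρ p.1 p.2).1, map_add, Pi.add_apply,
          Finset.sum_apply, Pi.mul_apply]
        rw [expand]
      rw [this]
      exact add_mem (h1 _ (hV ξ)) (sum_mem fun i _ =>
        mul_mem (h2 _ (hV (b.coord i))) (h1 _ (hL _ (hρ (b i) ξ))))
    · have hm : IsMorphism k (fun q : LV ρ × LV ρ => (q.1.right, q.2.right)) :=
        isMorphism_of_adjoin rfl _ (by
          rintro _ (⟨f, hf, rfl⟩ | ⟨f, hf, rfl⟩)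
          · exact h1 _ (hL f hf)
          · exact h2 _ (hL f hf))
      exact hm _ (AffineAlgebraicGroup.mul_morphism p hp)
  · refine isMorphism_of_adjoin (reg_LV k ρ) _ ?_
    rintro _ (⟨ξ, rfl⟩ | ⟨p, hp, rfl⟩)
    · have : ((fun g : LV ρ => ξ g.left.toAdd) ∘ fun g : LV ρ => g⁻¹) =
          -∑ i, (fun g : LV ρ => b.coord i g.left.toAdd) *
              (fun g : LV ρ => ξ ((ρ g.right⁻¹ : V →ₗ[k] V) (b i))) := by
        ext g
        have hg : (g⁻¹).left.toAdd = (ρ g.right⁻¹ : V →ₗ[k] V) (-g.left.toAdd) := rfl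
        simp only [Function.comp_apply, hg, map_neg, Pi.neg_apply,
          Finset.sum_apply, Pi.mul_apply]
        rw [expand]
      rw [this]
      exact neg_mem (sum_mem fun i _ => mul_mem (hV (b.coord i))
        (hL _ (AffineAlgebraicGroup.inv_morphism _ (hρ (b i) ξ))))
    · exact hL _ (AffineAlgebraicGroup.inv_morphism p hp)

end AlgGrp

/-!
Write `h = (v, u)` with `v ∈ V` and `u ∈ L`.

If `v = ρ(u) w - w` for some `w ∈ V`, conjugation by the translation `(w, 1)` carries `h` to
`(0, u)`, which lies in `L`.

Otherwise some linear form `ξ` on `V` vanishes on the image of `ρ(u) - 1` and satisfies `ξ(v) = 1`.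
The first property says that `ξ` is invariant under `ρ(u)`, so the regular function
`f(w, l) = ξ(ρ(l)⁻¹ w)` on `G = L ⋉ V` satisfies `f(g h) = f(g) + 1` for all `g`. For any affine
algebraic group `G` in characteristic zero and any unipotent `h`, the existence of such a function
makes `{f = 0}` a section (`isSection_zeroLocus`), for the following reasons.

Since `h` is unipotent, `n ↦ p(hⁿ)` is the restriction to `ℕ` of a polynomial `P` for every
regular `p`. By uniqueness of `P`, the map `p ↦ P(t)` is a character of `k[G]`, that is, a point
`γ(t)` of `G`; thus `n ↦ hⁿ` extends to a one-parameter subgroup `γ : k → G` with polynomial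
coordinates. Identities between polynomials need only be checked on `ℕ`, which gives
`f(g γ(t)) = f(g) + t`. Hence `x ∈ γ(k)` is equivalent to the closed condition `x = γ(f(x) - f(1))`, the
hull of `h` is `γ(k)`, and each coset `g γ(k)` contains exactly one zero of `f`. Each irreducible
component `C` is stable under `γ(k)`, because `C γ(k)` is again irreducible, so `{f = 0} ∩ C` is
the image of `C` under the morphism `g ↦ g γ(-f(g))`.
-/

namespace AlgGrp

open Polynomial

/-! ### Points and morphisms of affine varieties -/

section Variety

variable {k : Type*} [Field k] {X Y Z : Type*} [AffineVariety k X] [AffineVariety k Y]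
  [AffineVariety k Z]

/-- Regular functions separate points. -/
theorem ext_of_regular {x y : X} (hxy : ∀ p ∈ Reg k X, p x = p y) : x = y := by
  obtain ⟨z, -, hz⟩ := AffineVariety.existsUnique_eval (k := k) (X := X)
    ((Pi.evalAlgHom k (fun _ : X => k) x).comp (Reg k X).val)
  exact (hz x fun _ => rfl).trans (hz y fun p => hxy p.1 p.2).symm

theorem IsMorphism.comp {ψ : Y → Z} {φ : X → Y} (hψ : IsMorphism k ψ) (hφ : IsMorphism k φ) :
    IsMorphism k (ψ ∘ φ) :=
  fun p hp => hφ _ (hψ p hp)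

theorem isMorphism_id : IsMorphism k (id : X → X) := fun _ hp => hp

theorem isMorphism_const (y : Y) : IsMorphism k (fun _ : X => y) :=
  fun p _ => (Reg k X).algebraMap_mem (p y)

theorem IsMorphism.prodMk {φ : X → Y} {ψ : X → Z} (hφ : IsMorphism k φ) (hψ : IsMorphism k ψ) :
    IsMorphism k fun x => (φ x, ψ x) :=
  isMorphism_of_adjoin rfl _ (by
    rintro _ (⟨p, hp, rfl⟩ | ⟨p, hp, rfl⟩)
    · exact hφ p hp
    · exact hψ p hp)

theorem isZariskiClosed_forall {I : Set (X → k)} (hI : I ⊆ Reg k X) :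
    IsZariskiClosed k {x | ∀ p ∈ I, p x = 0} :=
  isZariskiClosed_iff.2 ⟨I, hI, rfl⟩

theorem isZariskiClosed_zeroLocus {p : X → k} (hp : p ∈ Reg k X) :
    IsZariskiClosed k {x | p x = 0} := by
  simpa using isZariskiClosed_forall (I := {p}) (by simpa using hp)

theorem IsMorphism.continuous {φ : X → Y} (hφ : IsMorphism k φ) :
    @Continuous X Y (zariski k X) (zariski k Y) φ := by
  let := zariski k X
  let := zariski k Y
  refine continuous_iff_isClosed.2 fun W hW => ?_
  obtain ⟨I, hI, rfl⟩ := isZariskiClosed_iff.1 hW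
  refine isZariskiClosed_iff.2 ⟨(· ∘ φ) '' I, ?_, ?_⟩
  · rintro _ ⟨p, hp, rfl⟩
    exact hφ p (hI hp)
  · ext x
    simp

/-- The basic open sets `{p ≠ 0}` form a basis of the Zariski topology. -/
theorem exists_basic_open {U : Set X} (hU : @IsOpen X (zariski k X) U) {x : X} (hx : x ∈ U) :
    ∃ p ∈ Reg k X, p x ≠ 0 ∧ ∀ y, p y ≠ 0 → y ∈ U := by
  let := zariski k X
  obtain ⟨I, hI, hUI⟩ := isZariskiClosed_iff.1 (show IsZariskiClosed k Uᶜ from hU.isClosed_compl)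
  have hx' : x ∉ {x | ∀ f ∈ I, f x = 0} := hUI ▸ fun h => h hx
  simp only [Set.mem_ofPred_eq, not_forall] at hx'
  obtain ⟨p, hp, hpx⟩ := hx'
  refine ⟨p, hI hp, hpx, fun y hy => ?_⟩
  by_contra hyU
  have hy' : y ∈ {x | ∀ f ∈ I, f x = 0} := hUI ▸ hyU
  exact hy (hy' p hp)

theorem isOpen_basic {p : X → k} (hp : p ∈ Reg k X) : @IsOpen X (zariski k X) {x | p x ≠ 0} := by
  let := zariski k X
  exact isOpen_compl_iff.2 (isZariskiClosed_zeroLocus hp)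

/-- Two regular functions that are each nonzero somewhere on an irreducible set are both nonzero
at some common point of it. -/
theorem IsZariskiIrreducible.exists_ne_zero {C : Set X} (hC : IsZariskiIrreducible k C)
    {p q : X → k} (hp : p ∈ Reg k X) (hq : q ∈ Reg k X) (hpC : ∃ x ∈ C, p x ≠ 0)
    (hqC : ∃ x ∈ C, q x ≠ 0) : ∃ x ∈ C, p x ≠ 0 ∧ q x ≠ 0 := by
  let := zariski k X
  exact hC.2 _ _ (isOpen_basic hp) (isOpen_basic hq) hpC hqC

/-- A polynomial in a regular function is regular. -/
theorem polynomial_eval_mem_reg {f : X → k} (hf : f ∈ Reg k X) (P : k[X]) :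
    (fun x => P.eval (f x)) ∈ Reg k X := by
  have hP : (fun x => P.eval (f x)) = aeval f P := by
    ext x
    rw [← Pi.evalAlgHom_apply k (fun _ : X => k) x (aeval f P), ← aeval_algHom_apply]
    simp [coe_aeval_eq_eval]
  rw [hP]
  exact Algebra.adjoin_le (Set.singleton_subset_iff.2 hf) (aeval_mem_adjoin_singleton k f)

end Variety

section Group

variable {k : Type*} [Field k] {G : Type*} [Group G] [AffineVariety k G]
  [AffineAlgebraicGroup k G]

theorem isMorphism_mul_left (a : G) : IsMorphism k fun g : G => a * g :=
  (AffineAlgebraicGroup.mul_morphism (k := k) (G := G)).comp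
    ((isMorphism_const a).prodMk isMorphism_id)

theorem isMorphism_mul_right (a : G) : IsMorphism k fun g : G => g * a :=
  (AffineAlgebraicGroup.mul_morphism (k := k) (G := G)).comp
    (isMorphism_id.prodMk (isMorphism_const a))

end Group

/-! ### The one-parameter subgroup through a unipotent element -/

/-- Polynomials over a field of characteristic zero that agree on `ℕ` are equal. -/
theorem polynomial_eq_of_eval_natCast {k : Type*} [Field k] [CharZero k] {P Q : k[X]}
    (hPQ : ∀ n : ℕ, P.eval (n : k) = Q.eval (n : k)) : P = Q :=
  eq_of_infinite_eval_eq P Q ((Set.infinite_range_of_injective Nat.cast_injective).mono (by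
    rintro _ ⟨n, rfl⟩
    exact hPQ n))

theorem exists_polynomial_choose (k : Type*) [Field k] [CharZero k] (i : ℕ) :
    ∃ P : k[X], ∀ n : ℕ, P.eval (n : k) = (n.choose i : k) := by
  refine ⟨C ((i.factorial : k)⁻¹) * descPochhammer k i, fun n => ?_⟩
  have hi : (i.factorial : k) ≠ 0 := Nat.cast_ne_zero.2 i.factorial_ne_zero
  rw [eval_mul, eval_C, descPochhammer_eval_eq_descFactorial,
    Nat.descFactorial_eq_factorial_mul_choose, Nat.cast_mul, inv_mul_cancel_left₀ hi]

section Unipotent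

variable {k : Type*} [Field k] [CharZero k] {G : Type*} [Group G] [AffineVariety k G]

/-- With `R` the right translation by `h`, one has `p(hⁿ) = (Rⁿ p)(1)`, and the binomial expansion
of `Rⁿ = (1 + (R - 1))ⁿ` stops at a power of `R - 1` that does not depend on `n`. -/
theorem IsUnipotent.exists_polynomial {h : G} (hh : IsUnipotent k h) {p : G → k}
    (hp : p ∈ Reg k G) : ∃ P : k[X], ∀ n : ℕ, P.eval (n : k) = p (h ^ n) := by
  obtain ⟨m, hm⟩ := hh p hp
  set R : Module.End k (G → k) := LinearMap.funLeft k k fun x : G => x * h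
  have hR : ∀ n : ℕ, p (h ^ n) = (R ^ n) p 1 := by
    intro n
    have hRn : ∀ (n : ℕ) (x : G), (R ^ n) p x = p (x * h ^ n) := by
      intro n
      induction n with
      | zero => simp
      | succ n ih =>
        intro x
        rw [pow_succ', Module.End.mul_apply]
        change (R ^ n) p (x * h) = _
        rw [ih, mul_assoc, pow_succ']
    rw [hRn, one_mul]
  choose Q hQ using exists_polynomial_choose k
  refine ⟨∑ i ∈ Finset.range m, C (((R - 1) ^ i) p 1) * Q i, fun n => ?_⟩
  have hvanish : ∀ i, m ≤ i → ((R - 1) ^ i) p = 0 := by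
    intro i hi
    obtain ⟨j, rfl⟩ := Nat.exists_eq_add_of_le' hi
    rw [pow_add, Module.End.mul_apply, hm, map_zero]
  have hbinom : p (h ^ n) =
      ∑ i ∈ Finset.range (n + 1), ((R - 1) ^ i) p 1 * (n.choose i : k) := by
    rw [hR]
    conv_lhs => rw [← sub_add_cancel R 1, (Commute.one_right (R - 1)).add_pow]
    simp only [one_pow, mul_one, LinearMap.sum_apply, Finset.sum_apply]
    refine Finset.sum_congr rfl fun i _ => ?_
    rw [← nsmul_eq_mul', LinearMap.smul_apply, Pi.smul_apply, nsmul_eq_mul, mul_comm]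
  -- Both truncations of the binomial sum agree with the sum over `i < m + n + 1`.
  rw [hbinom, eval_finsetSum]
  simp only [eval_mul, eval_C, hQ]
  rw [Finset.sum_subset (Finset.range_mono (show m ≤ m + (n + 1) by omega)),
    Finset.sum_subset (Finset.range_mono (show n + 1 ≤ m + (n + 1) by omega))]
  · intro i _ hi
    rw [Nat.choose_eq_zero_of_lt (by simpa using hi), Nat.cast_zero, mul_zero]
  · intro i _ hi
    rw [hvanish i (by simpa using hi), Pi.zero_apply, zero_mul]

/-- The curve `γ` interpolating `n ↦ hⁿ`: the point `γ(t)` is the character of `k[G]` that sends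
`p` to the value at `t` of the polynomial interpolating `n ↦ p(hⁿ)`. -/
theorem IsUnipotent.exists_curve {h : G} (hh : IsUnipotent k h) :
    ∃ γ : k → G, (∀ n : ℕ, γ n = h ^ n) ∧
      ∀ p ∈ Reg k G, ∃ P : k[X], ∀ t, p (γ t) = P.eval t := by
  choose P hP using fun p : Reg k G => hh.exists_polynomial p.2
  let φ : Reg k G →ₐ[k] k[X] :=
    { toFun := P
      map_one' := polynomial_eq_of_eval_natCast fun n => by rw [hP]; simp
      map_mul' := fun p q => polynomial_eq_of_eval_natCast fun n => by
        rw [hP, eval_mul, hP, hP]; rfl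
      map_zero' := polynomial_eq_of_eval_natCast fun n => by rw [hP]; simp
      map_add' := fun p q => polynomial_eq_of_eval_natCast fun n => by
        rw [hP, eval_add, hP, hP]; rfl
      commutes' := fun c => polynomial_eq_of_eval_natCast fun n => by
        rw [hP, algebraMap_eq, eval_C]; rfl }
  choose γ hγ using fun t : k =>
    (AffineVariety.existsUnique_eval (k := k) (X := G) ((aeval t).comp φ)).exists
  have hγP : ∀ (p : Reg k G) (t : k), p.1 (γ t) = (P p).eval t := fun p t =>
    (hγ t p).symm.trans (by rw [AlgHom.comp_apply, coe_aeval_eq_eval]; rfl)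
  exact ⟨γ, fun n => ext_of_regular fun p hp => (hγP ⟨p, hp⟩ n).trans (hP ⟨p, hp⟩ n),
    fun p hp => ⟨P ⟨p, hp⟩, hγP ⟨p, hp⟩⟩⟩

/-- A unipotent element `h` lies on a one-parameter subgroup `t ↦ γ(t)` with polynomial coordinates
and `γ(1) = h`. -/
theorem IsUnipotent.exists_oneParameter [AffineAlgebraicGroup k G] {h : G}
    (hh : IsUnipotent k h) :
    ∃ γ : Multiplicative k →* G, (∀ n : ℕ, γ (.ofAdd (n : k)) = h ^ n) ∧
      ∀ p ∈ Reg k G, ∃ P : k[X], ∀ t : k, p (γ (.ofAdd t)) = P.eval t := by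
  obtain ⟨γ, hγn, hγ⟩ := hh.exists_curve
  -- Two curves `s ↦ γ(s + t)` and `s ↦ γ(s) γ(t)` are compared on `ℕ`, first for `t ∈ ℕ`.
  have key : ∀ t : k, (∀ n : ℕ, γ (n + t) = h ^ n * γ t) → ∀ s, γ (s + t) = γ s * γ t := by
    intro t ht s
    refine ext_of_regular (k := k) fun p hp => ?_
    obtain ⟨P, hP⟩ := hγ p hp
    obtain ⟨Q, hQ⟩ := hγ _ (isMorphism_mul_right (γ t) p hp)
    have hPQ : P.comp (X + C t) = Q := polynomial_eq_of_eval_natCast fun n => by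
      rw [← hQ, eval_comp, eval_add, eval_X, eval_C, ← hP, ht, ← hγn]; rfl
    have hs := hQ s
    rw [← hPQ, eval_comp, eval_add, eval_X, eval_C, ← hP] at hs
    exact hs.symm
  have hnat : ∀ (m : ℕ) (s : k), γ (s + m) = γ s * γ m := fun m =>
    key m fun n => by rw [← Nat.cast_add, hγn, hγn, pow_add]
  have hnat' : ∀ (n : ℕ) (t : k), γ (n + t) = h ^ n * γ t := by
    intro n t
    refine ext_of_regular (k := k) fun p hp => ?_
    obtain ⟨P, hP⟩ := hγ p hp
    obtain ⟨Q, hQ⟩ := hγ _ (isMorphism_mul_left (h ^ n) p hp)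
    have hPQ : P.comp (C (n : k) + X) = Q := polynomial_eq_of_eval_natCast fun m => by
      rw [← hQ, eval_comp, eval_add, eval_X, eval_C, ← hP, hnat, hγn n]; rfl
    have ht := hQ t
    rw [← hPQ, eval_comp, eval_add, eval_X, eval_C, ← hP] at ht
    exact ht.symm
  exact ⟨{ toFun := fun t => γ t.toAdd
           map_one' := by simpa using hγn 0
           map_mul' := fun s t => key t.toAdd (fun n => hnat' n t.toAdd) s.toAdd }, hγn, hγ⟩

end Unipotent

/-! ### Sections from regular functions that grow linearly along cosets -/

section Section

variable {k : Type*} [Field k] [CharZero k] {G : Type*} [Group G] [AffineVariety k G]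
  [AffineAlgebraicGroup k G]

/-- An irreducible component `C` is stable under right translation by a one-parameter subgroup
`γ`: the set `C γ(k)` contains `C` and is irreducible, because nonempty open subsets of it meet on a
common curve `c γ(k)`. -/
theorem component_mul_oneParameter_mem {γ : Multiplicative k →* G}
    (hγ : ∀ p ∈ Reg k G, ∃ P : k[X], ∀ t : k, p (γ (.ofAdd t)) = P.eval t) {C : Set G}
    (hC : C ∈ components k G) {g : G} (hg : g ∈ C) (t : Multiplicative k) : g * γ t ∈ C := by
  let := zariski k G
  have hCirr : IsZariskiIrreducible k C := hC.prop
  let D : Set G := {x | ∃ c ∈ C, ∃ t, x = c * γ t}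
  have hCD : C ⊆ D := fun c hc => ⟨c, hc, 1, by simp⟩
  have hD : IsIrreducible D := by
    refine ⟨hCirr.1.mono hCD, ?_⟩
    rintro U₁ U₂ hU₁ hU₂ ⟨_, ⟨c₁, hc₁, t₁, rfl⟩, hx₁⟩ ⟨_, ⟨c₂, hc₂, t₂, rfl⟩, hx₂⟩
    obtain ⟨p₁, hp₁, hpx₁, hpU₁⟩ := exists_basic_open hU₁ hx₁
    obtain ⟨p₂, hp₂, hpx₂, hpU₂⟩ := exists_basic_open hU₂ hx₂
    -- For a suitable `c ∈ C` both `t ↦ pᵢ(c γ(t))` are nonzero polynomials.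
    obtain ⟨c, hc, h₁, h₂⟩ := hCirr.exists_ne_zero (isMorphism_mul_right (γ t₁) p₁ hp₁)
      (isMorphism_mul_right (γ t₂) p₂ hp₂) ⟨c₁, hc₁, hpx₁⟩ ⟨c₂, hc₂, hpx₂⟩
    obtain ⟨P₁, hP₁⟩ := hγ _ (isMorphism_mul_left c p₁ hp₁)
    obtain ⟨P₂, hP₂⟩ := hγ _ (isMorphism_mul_left c p₂ hp₂)
    have hne : P₁ * P₂ ≠ 0 := by
      refine mul_ne_zero ?_ ?_
      · rintro rfl
        exact h₁ ((hP₁ t₁.toAdd).trans eval_zero)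
      · rintro rfl
        exact h₂ ((hP₂ t₂.toAdd).trans eval_zero)
    obtain ⟨s, hs⟩ : ∃ s : k, (P₁ * P₂).eval s ≠ 0 := by
      by_contra! hzero
      exact hne (Polynomial.funext fun s => by rw [hzero s, eval_zero])
    rw [eval_mul, ← hP₁, ← hP₂] at hs
    exact ⟨c * γ (.ofAdd s), ⟨c, hc, _, rfl⟩, hpU₁ _ (left_ne_zero_of_mul hs),
      hpU₂ _ (right_ne_zero_of_mul hs)⟩
  exact hC.le_of_ge hD hCD ⟨g, hg, t, rfl⟩

/-- A regular function `f` with `f(g h) = f(g) + 1` identifies the hull of `h` with the additive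
group and trivializes the action of the hull by right translations: `{f = 0}` is a section. -/
theorem isSection_zeroLocus {h : G} (hh : IsUnipotent k h) {f : G → k} (hf : f ∈ Reg k G)
    (hfh : ∀ g, f (g * h) = f g + 1) : IsSection k (algebraicHull k h) {g | f g = 0} := by
  obtain ⟨γ, hγn, hγ⟩ := hh.exists_oneParameter
  have hfn : ∀ (g : G) (n : ℕ), f (g * h ^ n) = f g + n := by
    intro g n
    induction n with
    | zero => simp
    | succ n ih => rw [pow_succ, ← mul_assoc, hfh, ih, Nat.cast_succ, add_assoc]
  have hfγ : ∀ (g : G) (t : k), f (g * γ (.ofAdd t)) = f g + t := by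
    intro g t
    obtain ⟨P, hP⟩ := hγ _ (isMorphism_mul_left g f hf)
    have hPX : P = C (f g) + X := polynomial_eq_of_eval_natCast fun n => by
      rw [← hP, eval_add, eval_C, eval_X, ← hfn, ← hγn]; rfl
    have ht := hP t
    rw [hPX, eval_add, eval_C, eval_X] at ht
    exact ht
  have hγmem : ∀ t, γ t ∈ algebraicHull k h := by
    intro t
    refine Subgroup.mem_sInf.2 fun H hH => ?_
    obtain ⟨I, hI, hHI⟩ := isZariskiClosed_iff.1 hH.1
    rw [← SetLike.mem_coe, hHI]
    intro p hp
    obtain ⟨P, hP⟩ := hγ p (hI hp)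
    have hP0 : P = 0 := polynomial_eq_of_eval_natCast fun n => by
      have hn : h ^ n ∈ (H : Set G) := pow_mem hH.2 n
      rw [hHI] at hn
      rw [← hP, hγn, eval_zero]
      exact hn p hp
    rw [← ofAdd_toAdd t, hP, hP0, eval_zero]
  have hmor : ∀ {a : G → k}, a ∈ Reg k G → IsMorphism k fun g => γ (.ofAdd (a g)) := by
    intro a ha p hp
    obtain ⟨P, hP⟩ := hγ p hp
    have : p ∘ (fun g => γ (.ofAdd (a g))) = fun g => P.eval (a g) := funext fun g => hP (a g)
    rw [this]
    exact polynomial_eval_mem_reg ha P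
  -- The image of `γ` is the set of `x` with `x = γ(f(x) - f(1))`, hence closed.
  have hrange : algebraicHull k h ≤ γ.range := by
    refine (isLeast_algebraicHull k h).2 ⟨?_, ⟨.ofAdd 1, by simpa using hγn 1⟩⟩
    have hfγ1 : ∀ t : k, f (γ (.ofAdd t)) = f 1 + t := fun t => by simpa using hfγ 1 t
    have heq : (γ.range : Set G) =
        {x | ∀ q ∈ {q | ∃ p ∈ Reg k G, q = p - p ∘ fun g => γ (.ofAdd (f g - f 1))}, q x = 0} := by
      ext x
      constructor
      · rintro ⟨t, rfl⟩ _ ⟨p, hp, rfl⟩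
        have ht : f (γ t) - f 1 = t.toAdd := sub_eq_of_eq_add' (hfγ1 t.toAdd)
        rw [Pi.sub_apply, Function.comp_apply, ht, ofAdd_toAdd, sub_self]
      · intro hx
        refine ⟨.ofAdd (f x - f 1), (ext_of_regular (k := k) fun p hp => ?_).symm⟩
        exact sub_eq_zero.1 (hx _ ⟨p, hp, rfl⟩)
    change IsZariskiClosed k (γ.range : Set G)
    rw [heq]
    refine isZariskiClosed_forall ?_
    rintro _ ⟨p, hp, rfl⟩
    exact sub_mem hp (hmor (sub_mem hf ((Reg k G).algebraMap_mem (f 1))) p hp)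
  refine ⟨isZariskiClosed_zeroLocus hf, fun g => ?_, fun C hC => ?_⟩
  · rw [orbit_op_eq]
    refine ⟨g * γ (.ofAdd (-f g)), ⟨?_, _, hγmem _, rfl⟩, ?_⟩
    · change f _ = 0
      rw [hfγ, add_neg_cancel]
    · rintro _ ⟨hs, x, hx, rfl⟩
      obtain ⟨t, rfl⟩ := hrange hx
      have ht : f g + t.toAdd = 0 := (hfγ g t.toAdd).symm.trans hs
      rw [← ofAdd_toAdd t, eq_neg_of_add_eq_zero_right ht]
  · let := zariski k G
    let π : G → G := fun g => g * γ (.ofAdd (-f g))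
    have hπ : IsMorphism k π :=
      (AffineAlgebraicGroup.mul_morphism (k := k) (G := G)).comp
        (isMorphism_id.prodMk (hmor (neg_mem hf)))
    have himage : {g | f g = 0} ∩ C = π '' C := by
      ext x
      constructor
      · rintro ⟨hx, hxC⟩
        refine ⟨x, hxC, ?_⟩
        simp [π, show f x = 0 from hx]
      · rintro ⟨g, hg, rfl⟩
        refine ⟨?_, component_mul_oneParameter_mem hγ hC hg _⟩
        change f _ = 0
        rw [hfγ, add_neg_cancel]
    change IsIrreducible _
    rw [himage]
    have hCirr : IsIrreducible C := hC.prop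
    exact hCirr.image π hπ.continuous.continuousOn

end Section

/-! ### Elements of the semidirect product -/

section SemidirectProduct

variable {k : Type*} [Field k] {L : Type*} [Group L] {V : Type*} [AddCommGroup V] [Module k V]

/-- Conjugating `(ρ(u) w - w, u)` by the translation `(w, 1)` gives `(0, u)`. -/
theorem isConj_inr_right (ρ : L →* LinearMap.GeneralLinearGroup k V) {h : LV ρ} {w : V}
    (hw : (ρ h.right : V →ₗ[k] V) w - w = h.left.toAdd) :
    IsConj h (SemidirectProduct.inr h.right : LV ρ) := by
  refine isConj_iff.2 ⟨SemidirectProduct.inl (.ofAdd w), mul_inv_eq_iff_eq_mul.2 ?_⟩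
  refine SemidirectProduct.ext ?_ ?_
  · apply Multiplicative.toAdd.injective
    rw [(mul_formula ρ _ _).1, (mul_formula ρ _ _).1]
    simp [← hw]
  · simp

/-- If `ξ` is invariant under the `L`-part of `x`, the function `(w, l) ↦ ξ(ρ(l)⁻¹ w)`, which is
`g ↦ -ξ((g⁻¹).left)`, satisfies `f(g x) = f(g) + f(x)` with `f(x) = ξ(x.left)`. -/
theorem neg_apply_inv_left_mul (ρ : L →* LinearMap.GeneralLinearGroup k V) {x : LV ρ}
    {ξ : Module.Dual k V} (hξ : ∀ w, ξ ((ρ x.right : V →ₗ[k] V) w) = ξ w) (g : LV ρ) :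
    -ξ ((g * x)⁻¹).left.toAdd = -ξ (g⁻¹).left.toAdd + ξ x.left.toAdd := by
  have hinv : ∀ w, ξ ((ρ x.right⁻¹ : V →ₗ[k] V) w) = ξ w := by
    intro w
    rw [← hξ, ← Module.End.mul_apply, ← Units.val_mul, ← map_mul, mul_inv_cancel, map_one]
    rfl
  have hx : (x⁻¹).left.toAdd = (ρ x.right⁻¹ : V →ₗ[k] V) (-x.left.toAdd) := rfl
  rw [mul_inv_rev, (mul_formula ρ _ _).1, map_add, SemidirectProduct.inv_right, hinv, hx, hinv,
    map_neg]
  ring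

end SemidirectProduct

end AlgGrp

theorem mainTheorem2 {k : Type*} [Field k] [IsAlgClosed k] [CharZero k]
    {L : Type*} [Group L] [AlgGrp.AffineVariety k L] [AlgGrp.AffineAlgebraicGroup k L]
    (hL : AlgGrp.IsReductive k L)
    {V : Type*} [AddCommGroup V] [Module k V] [FiniteDimensional k V]
    (ρ : L →* LinearMap.GeneralLinearGroup k V) (hρ : AlgGrp.IsRational k ρ)
    (h : AlgGrp.LV ρ) (hh : AlgGrp.IsUnipotent k h) :
    (∃ h' : L, IsConj h (SemidirectProduct.inr h' : AlgGrp.LV ρ)) ∨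
      ∃ S : Set (AlgGrp.LV ρ), AlgGrp.IsSection k (AlgGrp.algebraicHull k h) S := by
  have := AlgGrp.affineAlgebraicGroup_LV k ρ hρ
  let T : V →ₗ[k] V := (ρ h.right : V →ₗ[k] V) - 1
  by_cases hv : h.left.toAdd ∈ LinearMap.range T
  · obtain ⟨w, hw⟩ := hv
    exact Or.inl ⟨h.right, AlgGrp.isConj_inr_right ρ hw⟩
  · obtain ⟨ξ₀, hξ₀, hT⟩ := Submodule.exists_le_ker_of_notMem hv
    -- Rescaled so that `ξ` takes the value `1` on the `V`-part of `h`.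
    let ξ : Module.Dual k V := (ξ₀ h.left.toAdd)⁻¹ • ξ₀
    have hξ1 : ξ h.left.toAdd = 1 := inv_mul_cancel₀ hξ₀
    have hξ : ∀ w, ξ ((ρ h.right : V →ₗ[k] V) w) = ξ w := by
      intro w
      have hw : ξ₀ (T w) = 0 := hT ⟨w, rfl⟩
      have hw' : ξ₀ ((ρ h.right : V →ₗ[k] V) w) = ξ₀ w := by
        rw [← sub_eq_zero, ← map_sub]
        exact hw
      simp only [ξ, LinearMap.smul_apply, hw']
    have hreg : (fun g : AlgGrp.LV ρ => ξ g.left.toAdd) ∈ AlgGrp.Reg k (AlgGrp.LV ρ) := by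
      rw [AlgGrp.reg_LV]
      exact Algebra.subset_adjoin (Or.inl ⟨ξ, rfl⟩)
    refine Or.inr ⟨_, AlgGrp.isSection_zeroLocus hh (f := fun g => -ξ (g⁻¹).left.toAdd)
      (neg_mem (AlgGrp.AffineAlgebraicGroup.inv_morphism _ hreg)) fun g => ?_⟩
    rw [AlgGrp.neg_apply_inv_left_mul ρ hξ, hξ1]
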